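/- For a finite insoluble group $G$ let $R(G)$ denote its soluble radical, i.e. its largest soluble normal subgroup. The solubility graph $\Gamma_{\mathrm S}(G)$ is the simple graph with vertex set $G\setminus R(G)$ in which two distinct vertices $x,y$ are adjacent if and only if the subgroup $\langle x,y\rangle$ is soluble. For finite insoluble groups $G,H$ write $\Gamma_{\mathrm S}(G)\cong\Gamma_{\mathrm S}(H)$ if there is a one-to-one correspondence $\phi: G\setminus R(G)\to H\setminus R(H)$ that preserves edges, i.e. if $\langle x,y\rangle$ is soluble then so is $\langle \phi(x),\phi(y)\rangle$, for all $x,y\in G\setminus R(G)$ (in particular, this holds if the two graphs are isomorphic). Let $G$ be a finite insoluble group such that $\Gamma_{\mathrm S}(G)\cong\Gamma_{\mathrm S}(A_6)$. Then $|G|=|A_6|=360$, and $G$ is isomorphic to one of the following groups: $$A_6,\quad C_3\rtimes S_5,\quad C_3\times S_5,\quad S_3\times A_5,\quad C_6\times A_5,\quad C_3\times \mathrm{SL}(2,5),$$ where in $C_3\rtimes S_5$ the even permutations act trivially on $C_3$ and the odd permutations act by inversion. Furthermore, if $G$ is quasisimple (that is, $G$ is perfect and $G/Z(G)$ is simple)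 or almost simple (that is, up to isomorphism $\mathrm{Inn}(T)\le G\le \mathrm{Aut}(T)$ for some nonabelian simple group $T$), then $G\cong A_6$. -/

import Mathlib

/-- The soluble radical of `G`: the subgroup generated by all soluble normal subgroups of `G`.
For finite `G` this is the largest soluble normal subgroup of `G`. -/
def solubleRadical (G : Type*) [Group G] : Subgroup G :=
  sSup {N : Subgroup G | N.Normal ∧ Group.IsSolvable N}

/-- The solubility graph of `G`: the vertices are the elements of `G` outside the soluble radical,
and two distinct vertices are adjacent iff they generate a soluble subgroup. -/
def solubilityGraph (G : Type*) [Group G] : SimpleGraph {x : G // x ∉ solubleRadical G} where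
  Adj x y := x ≠ y ∧ Group.IsSolvable (Subgroup.closure {(x : G), (y : G)})
  symm := ⟨fun x y h => ⟨h.1.symm, by rw [Set.pair_comm]; exact h.2⟩⟩
  loopless := ⟨fun _ h => h.1 rfl⟩

/-- There is a one-to-one correspondence between the vertices of the solubility graphs of `G` and
`H` that preserves edges. Only edges of the first graph are required to go to edges of the second;
in particular this holds if the graphs are isomorphic, see `SameSolubilityGraph.of_iso`. -/
def SameSolubilityGraph (G H : Type*) [Group G] [Group H] : Prop :=
  ∃ φ : solubilityGraph G →g solubilityGraph H, Function.Bijective φ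

theorem SameSolubilityGraph.of_iso {G H : Type*} [Group G] [Group H]
    (e : solubilityGraph G ≃g solubilityGraph H) : SameSolubilityGraph G H :=
  ⟨e.toHom, e.bijective⟩

/-- A group is quasisimple if it is perfect and simple modulo its centre. -/
def IsQuasisimpleGroup (G : Type*) [Group G] : Prop :=
  commutator G = ⊤ ∧ IsSimpleGroup (G ⧸ Subgroup.center G)

/-- A group `G` is almost simple if, up to isomorphism, `Inn T ≤ G ≤ Aut T` for some nonabelian
simple group `T`. (Such a `T` embeds in `G`, so nothing is lost by taking it in the same
universe.) -/
def IsAlmostSimpleGroup.{u} (G : Type u) [Group G] : Prop :=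
  ∃ (T : Type u) (_ : Group T), IsSimpleGroup T ∧ (∃ a b : T, a * b ≠ b * a) ∧
    ∃ f : G →* MulAut T, Function.Injective f ∧ (MulAut.conj : T →* MulAut T).range ≤ f.range

/-- The cyclic group of order `n` (for positive `n`), written multiplicatively. -/
abbrev Cyc (n : ℕ) : Type := Multiplicative (ZMod n)

/-- The nontrivial action of `S₅` on `C₃`: a permutation `σ` acts by `c ↦ c ^ sign σ`, that is,
even permutations act trivially and odd permutations act by inversion. -/
def signActionC3 : Equiv.Perm (Fin 5) →* MulAut (Cyc 3) where
  toFun σ :=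
    { toFun := fun c => c ^ ((Equiv.Perm.sign σ : ℤˣ) : ℤ)
      invFun := fun c => c ^ ((Equiv.Perm.sign σ : ℤˣ) : ℤ)
      left_inv := fun c => by simp [← zpow_mul, ← Units.val_mul]
      right_inv := fun c => by simp [← zpow_mul, ← Units.val_mul]
      map_mul' := fun a b => mul_zpow a b _ }
  map_one' := by ext c; simp
  map_mul' σ τ := by
    ext c
    simp [← zpow_mul, mul_comm]

/-! The graph is used only through its number of vertices. Since `A₆` has trivial soluble radical,
`|G| - |R(G)| = 359`, so `|R(G)|` divides the prime 359. The value 359 would give a normal subgroup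
of prime order and index 2, making `G` soluble. Hence `|G| = 360` and `R(G) = 1`; in particular `G`
has no nontrivial normal `p`-subgroup. It remains to see that this property determines `G` up to
isomorphism, as `A₆` has it too.

Such a `G` has ten Sylow 3-subgroups and permutes them faithfully. The crux is that any two of them
meet trivially (`eq_one_of_mem_of_mem`): each then acts regularly on the other nine, and `G` is
doubly transitive. Counting elements of odd order shows that `G` has no subgroup of index 2, so it
acts by even permutations; this forces an involution fixing two points to invert the Sylow
3-subgroup, and the two-point stabilizer to be cyclic of order 4.

The ten points can now be labelled by the projective line over `F₉ = F₃[i]`, with a Sylow 3-subgroup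
acting by translations and the two-point stabilizer generated by multiplication by `i` (`rot`). A
finite check shows that an element interchanging 0 and infinity is `z ↦ 1/z` up to powers of `i`. So
the image of `G` is one fixed permutation group, the same for every such `G`, and `G ≅ A₆`. -/

/-- A finite group of order `360` without nontrivial normal subgroups of prime power order. -/
structure IsCoreFree360 (G : Type*) [Group G] : Prop where
  card_eq : Nat.card G = 360
  eq_bot_of_normal : ∀ (p : ℕ) [Fact p.Prime] (N : Subgroup G), N.Normal → IsPGroup p N → N = ⊥

/-! ### Conjugation action on Sylow subgroups -/

section SylowAction

variable {G : Type*} [Group G] {p : ℕ}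

theorem Sylow.mem_smul_iff {g x : G} {P : Sylow p G} : x ∈ g • P ↔ g⁻¹ * x * g ∈ P := by
  rw [← SetLike.mem_coe, Sylow.coe_smul, Set.mem_smul_set_iff_inv_smul_mem]
  simp [← map_inv, MulAut.smul_def, MulAut.conj_apply]

theorem Sylow.smul_eq_of_mem {x : G} {P : Sylow p G} (hx : x ∈ P) : x • P = P :=
  Sylow.smul_eq_iff_mem_normalizer.2 (Subgroup.le_normalizer hx)

theorem Sylow.isPGroup_zpowers {x : G} {P : Sylow p G} (hx : x ∈ P) :
    IsPGroup p (Subgroup.zpowers x) :=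
  P.isPGroup'.to_le ((Subgroup.zpowers_le).2 hx)

theorem Sylow.mem_of_isPGroup_zpowers {x : G} {P : Sylow p G}
    (hx : IsPGroup p (Subgroup.zpowers x)) (h : x • P = P) : x ∈ P := by
  have hle : Subgroup.zpowers x ≤ Subgroup.normalizer (P : Set G) :=
    Subgroup.zpowers_le.2 (Sylow.smul_eq_iff_mem_normalizer.1 h)
  have := hx.inf_normalizer_sylow P
  rw [inf_eq_left.2 hle] at this
  have h2 : Subgroup.zpowers x ≤ (P : Subgroup G) := by rw [this]; exact inf_le_right
  exact h2 (Subgroup.mem_zpowers x)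

theorem isPGroup_zpowers_of_orderOf {x : G} (h : orderOf x = p) :
    IsPGroup p (Subgroup.zpowers x) :=
  IsPGroup.of_card (n := 1) (by rw [Nat.card_zpowers, h, pow_one])

end SylowAction

/-! ### Numbers of Sylow subgroups and faithfulness -/

namespace IsCoreFree360

variable {G : Type*} [Group G] (hG : IsCoreFree360 G)
include hG

/-- The intersection of all Sylow `p`-subgroups is a normal `p`-subgroup. -/
theorem eq_one_of_forall_mem {p : ℕ} [Fact p.Prime] {x : G} (hx : ∀ P : Sylow p G, x ∈ P) :
    x = 1 := by
  let N : Subgroup G := ⨅ P : Sylow p G, (P : Subgroup G)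
  have hN : N.Normal := by
    refine ⟨fun n hn g => ?_⟩
    simp only [N, Subgroup.mem_iInf] at hn ⊢
    intro P
    have := hn (g⁻¹ • P)
    have h2 : n ∈ g⁻¹ • P := this
    rw [Sylow.mem_smul_iff] at h2
    exact (show g * n * g⁻¹ ∈ P by simpa using h2)
  have hp : IsPGroup p N := (default : Sylow p G).isPGroup'.to_le (iInf_le _ _)
  have := hG.eq_bot_of_normal p N hN hp
  rw [← Subgroup.mem_bot, ← this]
  exact Subgroup.mem_iInf.2 hx

variable [Finite G]

theorem card_sylow_coe_three (P : Sylow 3 G) : Nat.card P = 9 := by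
  have hf : (360 : ℕ).factorization 3 = 2 := by
    rw [show (360 : ℕ) = 3 ^ 2 * 40 by norm_num,
      Nat.factorization_mul (by norm_num) (by norm_num), Nat.Prime.factorization_pow (by norm_num),
      Finsupp.add_apply, Nat.factorization_eq_zero_of_not_dvd (n := 40) (by norm_num)]
    simp
  have := P.card_eq_multiplicity
  rw [hG.card_eq, hf] at this
  exact this

theorem mul_comm_of_mem {P : Sylow 3 G} {x y : G} (hx : x ∈ P) (hy : y ∈ P) : x * y = y * x := by
  have := IsPGroup.isMulCommutative_of_card_eq_prime_sq (p := 3) (G := P)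
    (by rw [hG.card_sylow_coe_three]; norm_num)
  exact congrArg Subtype.val (this.is_comm.comm (⟨x, hx⟩ : P) ⟨y, hy⟩)

theorem card_sylow_coe_five (P : Sylow 5 G) : Nat.card P = 5 := by
  have : Fact (Nat.Prime 5) := ⟨by norm_num⟩
  have hf : (360 : ℕ).factorization 5 = 1 := by
    rw [show (360 : ℕ) = 5 ^ 1 * 72 by norm_num,
      Nat.factorization_mul (by norm_num) (by norm_num), Nat.Prime.factorization_pow (by norm_num),
      Finsupp.add_apply, Nat.factorization_eq_zero_of_not_dvd (n := 72) (by norm_num)]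
    simp
  have := P.card_eq_multiplicity
  rw [hG.card_eq, hf] at this
  exact this

theorem card_sylow_ne_one {p : ℕ} [Fact p.Prime] (hp : p ∣ 360) : Nat.card (Sylow p G) ≠ 1 := by
  intro h
  have : Subsingleton (Sylow p G) := (Nat.card_eq_one_iff_unique.1 h).1
  obtain ⟨x, hx⟩ := exists_prime_orderOf_dvd_card' (G := G) p (by rwa [hG.card_eq])
  obtain ⟨P, hP⟩ := (isPGroup_zpowers_of_orderOf hx).exists_le_sylow
  have h1 : x = 1 := hG.eq_one_of_forall_mem (p := p) fun P' => by
    rw [Subsingleton.elim P' P]; exact hP (Subgroup.mem_zpowers x)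
  rw [h1, orderOf_one] at hx
  exact (Fact.out : p.Prime).one_lt.ne hx

theorem card_sylow_five : Nat.card (Sylow 5 G) = 6 ∨ Nat.card (Sylow 5 G) = 36 := by
  have : Fact (Nat.Prime 5) := ⟨by norm_num⟩
  have h1 := card_sylow_modEq_one 5 G
  have h2 := (default : Sylow 5 G).card_dvd_index
  have h3 := Subgroup.card_mul_index ((default : Sylow 5 G) : Subgroup G)
  have h4 := hG.card_sylow_ne_one (p := 5) (by norm_num)
  rw [hG.card_sylow_coe_five, hG.card_eq] at h3
  rw [show ((default : Sylow 5 G) : Subgroup G).index = 72 by omega] at h2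
  generalize Nat.card (Sylow 5 G) = n at *
  have h5 : n ∈ Nat.divisors 72 := by simp [h2]
  rw [show Nat.divisors 72 = {1, 2, 3, 4, 6, 8, 9, 12, 18, 24, 36, 72} by decide +kernel] at h5
  simp only [Finset.mem_insert, Finset.mem_singleton] at h5
  -- Among the divisors of 72 only 1, 6 and 36 are congruent to 1 modulo 5.
  unfold Nat.ModEq at h1
  omega

/-- With 40 conjugates, `P` would be its own normalizer; being abelian, it would have a normal
complement of order 40 by Burnside's transfer theorem. The Sylow 5-subgroup of that complement is
unique, hence characteristic, hence normal in `G`. -/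
theorem card_sylow_three_ne_forty : Nat.card (Sylow 3 G) ≠ 40 := by
  have : Fact (Nat.Prime 5) := ⟨by norm_num⟩
  intro h
  let P : Sylow 3 G := default
  have hcP := hG.card_sylow_coe_three P
  have hN : Nat.card (Subgroup.normalizer (P : Set G)) = 9 := by
    have h1 := P.card_eq_index_normalizer
    have h2 := Subgroup.card_mul_index (Subgroup.normalizer (P : Set G))
    rw [← h1, h, hG.card_eq] at h2
    omega
  have hPN : (P : Subgroup G) = Subgroup.normalizer (P : Set G) :=
    Subgroup.eq_of_le_of_card_ge Subgroup.le_normalizer (by rw [hN]; exact hcP.ge)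
  have hle : Subgroup.normalizer (P : Set G) ≤ Subgroup.centralizer (P : Set G) := by
    intro x hx
    have hx' : x ∈ (P : Subgroup G) := by rw [hPN]; exact hx
    rw [Subgroup.mem_centralizer_iff]
    intro y hy
    exact hG.mul_comm_of_mem hy hx'
  let K := (MonoidHom.transferSylow P hle).ker
  have hK : Nat.card K = 40 := by
    have h1 := (MonoidHom.ker_transferSylow_isComplement' P hle).card_mul_card
    rw [hG.card_eq] at h1
    have : Nat.card (P : Subgroup G) = 9 := hcP
    rw [this] at h1
    change Nat.card K * 9 = 360 at h1
    omega
  have hKn : K.Normal := inferInstance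
  let S : Sylow 5 K := default
  have h5 : Nat.card (Sylow 5 K) = 1 := by
    have h1 := card_sylow_modEq_one 5 K
    have h2 := S.card_dvd_index
    have h3 := Subgroup.card_mul_index (S : Subgroup K)
    have h4 : 5 ∣ Nat.card S := S.dvd_card_of_dvd_card (by rw [hK]; norm_num)
    rw [hK] at h3
    obtain ⟨k, hk⟩ := h4
    have hk' : Nat.card (S : Subgroup K) = 5 * k := hk
    rw [hk'] at h3
    have h6 : (S : Subgroup K).index ∣ 8 := ⟨k, by nlinarith⟩
    have h7 := h2.trans h6
    generalize Nat.card (Sylow 5 K) = n at *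
    have h8 : n ∈ Nat.divisors 8 := by simp [h7]
    rw [show Nat.divisors 8 = {1, 2, 4, 8} by decide +kernel] at h8
    simp only [Finset.mem_insert, Finset.mem_singleton] at h8
    unfold Nat.ModEq at h1
    omega
  have : Subsingleton (Sylow 5 K) := (Nat.card_eq_one_iff_unique.1 h5).1
  have : (S : Subgroup K).Characteristic := Sylow.characteristic_of_subsingleton S
  have hn : ((S : Subgroup K).map K.subtype).Normal := inferInstance
  have hb := hG.eq_bot_of_normal 5 _ hn (S.isPGroup'.map K.subtype)
  rw [Subgroup.map_eq_bot_iff_of_injective _ K.subtype_injective] at hb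
  exact S.ne_bot_of_dvd_card (by rw [hK]; norm_num) hb

/-- An element of order 3 that normalizes a Sylow 3-subgroup lies in it. -/
theorem not_three_dvd_card_ker :
    ¬ 3 ∣ Nat.card (MulAction.toPermHom G (Sylow 3 G)).ker := by
  intro h
  obtain ⟨x, hx⟩ := exists_prime_orderOf_dvd_card' 3 h
  have hx' : orderOf (x : G) = 3 := (Subgroup.orderOf_coe x).trans hx
  have h1 : (x : G) = 1 := hG.eq_one_of_forall_mem (p := 3) fun P =>
    Sylow.mem_of_isPGroup_zpowers (isPGroup_zpowers_of_orderOf hx')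
      (Equiv.Perm.congr_fun (MonoidHom.mem_ker.1 x.2) P)
  rw [h1, orderOf_one] at hx'
  norm_num at hx'

theorem card_sylow_three : Nat.card (Sylow 3 G) = 10 := by
  have h1 := card_sylow_modEq_one 3 G
  have h2 := (default : Sylow 3 G).card_dvd_index
  have h3 := Subgroup.card_mul_index ((default : Sylow 3 G) : Subgroup G)
  have h4 := hG.card_sylow_ne_one (p := 3) (by norm_num)
  have h6 := hG.card_sylow_three_ne_forty
  -- An action on four points has a kernel of index dividing 24, so of order divisible by 15.
  have h7 : Nat.card (Sylow 3 G) ≠ 4 := by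
    intro h
    have ha := Subgroup.card_mul_index (MulAction.toPermHom G (Sylow 3 G)).ker
    have hb := hG.not_three_dvd_card_ker
    have hc : (MulAction.toPermHom G (Sylow 3 G)).ker.index ∣ 24 := by
      rw [Subgroup.index_ker]
      refine (Subgroup.card_subgroup_dvd_card _).trans ?_
      rw [Nat.card_perm, h]
      decide
    rw [hG.card_eq] at ha
    obtain ⟨k, hk⟩ := hc
    refine hb ?_
    have : Nat.card (MulAction.toPermHom G (Sylow 3 G)).ker * 24 = 360 * k := by
      rw [hk, ← ha]; ring
    omega
  rw [hG.card_sylow_coe_three, hG.card_eq] at h3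
  rw [show ((default : Sylow 3 G) : Subgroup G).index = 40 by omega] at h2
  generalize Nat.card (Sylow 3 G) = n at *
  have h5 : n ∈ Nat.divisors 40 := by simp [h2]
  rw [show Nat.divisors 40 = {1, 2, 4, 5, 8, 10, 20, 40} by decide +kernel] at h5
  simp only [Finset.mem_insert, Finset.mem_singleton] at h5
  unfold Nat.ModEq at h1
  omega

theorem card_stabilizer (P : Sylow 3 G) : Nat.card (MulAction.stabilizer G P) = 36 := by
  have h1 := P.card_eq_index_normalizer
  have h2 := Subgroup.card_mul_index (Subgroup.normalizer (P : Set G))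
  rw [← h1, hG.card_sylow_three, hG.card_eq] at h2
  rw [Sylow.stabilizer_eq_normalizer]
  omega

/-- The kernel lies in a normalizer of order 36 and has order prime to 3, so it is a normal
2-subgroup. -/
theorem eq_one_of_forall_smul_eq {g : G} (h : ∀ P : Sylow 3 G, g • P = P) : g = 1 := by
  let K := (MulAction.toPermHom G (Sylow 3 G)).ker
  have hle : K ≤ MulAction.stabilizer G (default : Sylow 3 G) := fun x hx =>
    Equiv.Perm.congr_fun (MonoidHom.mem_ker.1 hx) _
  have h36 := Subgroup.card_dvd_of_le hle
  rw [hG.card_stabilizer] at h36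
  have h4 : Nat.card K ∣ 2 ^ 2 := by
    have hc : Nat.Coprime (Nat.card K) 9 := by
      rw [show 9 = 3 ^ 2 by norm_num]
      exact ((Nat.Prime.coprime_iff_not_dvd (by norm_num)).2
        hG.not_three_dvd_card_ker).symm.pow_right 2
    exact hc.dvd_of_dvd_mul_left (by norm_num; exact h36)
  have hb := hG.eq_bot_of_normal 2 K inferInstance (IsPGroup.of_card_dvd_pow h4)
  rw [← Subgroup.mem_bot, ← hb]
  exact MonoidHom.mem_ker.2 (Equiv.ext h)

end IsCoreFree360

/-! ### Trivial intersection of Sylow 3-subgroups -/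

section SylowAction

variable {G : Type*} [Group G]

theorem card_sylow_mem_conj (g x : G) :
    Nat.card {R : Sylow 3 G // g * x * g⁻¹ ∈ R} = Nat.card {R : Sylow 3 G // x ∈ R} := by
  refine (Nat.card_congr ((MulAction.toPerm g : Equiv.Perm (Sylow 3 G)).subtypeEquiv ?_)).symm
  intro R
  rw [MulAction.toPerm_apply, Sylow.mem_smul_iff]
  simp [mul_assoc]

/-- Inversion pairs off these elements: `x` and `x⁻¹` lie in the same subgroups, and differ unless
`x ^ 2 = 1`. -/
theorem even_card_filter_sylow_mem [Fintype G] [DecidableEq G] (k : ℕ) :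
    Even (Finset.univ.filter fun x : G =>
      orderOf x ≠ 1 ∧ orderOf x ≠ 2 ∧ Nat.card {R : Sylow 3 G // x ∈ R} = k).card := by
  rw [← ZMod.natCast_eq_zero_iff_even, Finset.card_eq_sum_ones, Nat.cast_sum]
  refine Finset.sum_involution (fun x _ => x⁻¹) (fun _ _ => by decide) ?_ ?_ (fun _ _ => inv_inv _)
  · intro x hx _ h
    simp only [Finset.mem_filter, Finset.mem_univ, true_and] at hx
    have : x ^ 2 = 1 := by rw [pow_two]; exact (eq_inv_iff_mul_eq_one.1 h.symm)
    have := (Nat.dvd_prime Nat.prime_two).1 (orderOf_dvd_of_pow_eq_one this)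
    tauto
  · intro x hx
    simpa using hx

end SylowAction

namespace IsCoreFree360

variable {G : Type*} [Group G] [Finite G] (hG : IsCoreFree360 G)
include hG

/-- The stabilizer of `P'` in `P` is `P ∩ P' = 1`, so the orbit of `P'` has nine elements: all Sylow
3-subgroups but `P`. -/
theorem exists_smul_eq_of_disjoint {P P' : Sylow 3 G} (hne : P' ≠ P)
    (h : ∀ x ∈ P, x ∈ P' → x = 1) {R : Sylow 3 G} (hR : R ≠ P) : ∃ q ∈ P, q • P' = R := by
  classical
  have hq (q : P) : (q : G) • P' ≠ P := by
    intro h1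
    apply hne
    exact smul_left_cancel (q : G) (h1.trans (Sylow.smul_eq_of_mem q.2).symm)
  let f : P → {R : Sylow 3 G // R ≠ P} := fun q => ⟨(q : G) • P', hq q⟩
  have hf : Function.Injective f := by
    intro q r hqr
    have h1 : (q : G) • P' = (r : G) • P' := congrArg Subtype.val hqr
    have h2 : ((r : G)⁻¹ * q) • P' = P' := by rw [mul_smul, h1, inv_smul_smul]
    have h3 : (r : G)⁻¹ * q ∈ P := mul_mem (inv_mem r.2) q.2
    have h4 := h _ h3 (Sylow.mem_of_isPGroup_zpowers (Sylow.isPGroup_zpowers h3) h2)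
    exact Subtype.ext (inv_mul_eq_one.1 h4).symm
  have hcard : Nat.card {R : Sylow 3 G // R ≠ P} ≤ Nat.card P := by
    have := Fintype.ofFinite (Sylow 3 G)
    have h10 := hG.card_sylow_three
    rw [hG.card_sylow_coe_three, Nat.card_eq_fintype_card, Fintype.card_subtype_compl,
      Fintype.card_subtype_eq, ← Nat.card_eq_fintype_card, h10]
  obtain ⟨q, hq⟩ := (hf.bijective_of_nat_card_le hcard).2 ⟨R, hR⟩
  exact ⟨q, q.2, congrArg Subtype.val hq⟩

/-- Regularity of `P` on the other nine gives double transitivity, so all pairs meet alike. -/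
theorem eq_one_of_mem_of_disjoint {P P' : Sylow 3 G} (hne : P' ≠ P)
    (h : ∀ x ∈ P, x ∈ P' → x = 1) {R R' : Sylow 3 G} (hR : R' ≠ R) {x : G} (hx : x ∈ R)
    (hx' : x ∈ R') : x = 1 := by
  obtain ⟨g, rfl⟩ := MulAction.exists_smul_eq G P R
  have h1 : g⁻¹ • R' ≠ P := by rintro h2; exact hR (by rw [← h2, smul_inv_smul])
  obtain ⟨q, hq, hqP⟩ := hG.exists_smul_eq_of_disjoint hne h h1
  rw [← inv_smul_smul g⁻¹ (R'), ← hqP, inv_inv, Sylow.mem_smul_iff, Sylow.mem_smul_iff] at hx'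
  rw [Sylow.mem_smul_iff] at hx
  have := h _ (mul_mem (mul_mem (inv_mem hq) hx) hq) hx'
  have h3 : x = (g * q) * (q⁻¹ * (g⁻¹ * x * g) * q) * (g * q)⁻¹ := by group
  rw [h3, this]; group

theorem card_inter {P P' : Sylow 3 G} (hne : P' ≠ P) {x : G} (hx : x ∈ P)
    (hx' : x ∈ P') (h1 : x ≠ 1) : Nat.card ((P : Subgroup G) ⊓ P' : Subgroup G) = 3 := by
  have hd := Subgroup.card_dvd_of_le (inf_le_left : (P : Subgroup G) ⊓ P' ≤ P)
  have h9 : Nat.card (P : Subgroup G) = 9 := hG.card_sylow_coe_three P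
  have h9' : Nat.card (P' : Subgroup G) = 9 := hG.card_sylow_coe_three P'
  rw [h9, show 9 = 3 ^ 2 by norm_num, Nat.dvd_prime_pow Nat.prime_three] at hd
  obtain ⟨k, hk, hkc⟩ := hd
  interval_cases k
  · rw [pow_zero, Subgroup.card_eq_one] at hkc
    have : x ∈ (P : Subgroup G) ⊓ P' := ⟨hx, hx'⟩
    rw [hkc, Subgroup.mem_bot] at this
    exact absurd this h1
  · simpa using hkc
  · have e1 := Subgroup.eq_of_le_of_card_ge (inf_le_left : (P : Subgroup G) ⊓ P' ≤ P)
      (by rw [hkc, h9]; norm_num)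
    have e2 := Subgroup.eq_of_le_of_card_ge (inf_le_right : (P : Subgroup G) ⊓ P' ≤ P')
      (by rw [hkc, h9']; norm_num)
    exact absurd (Sylow.ext (e2.symm.trans e1)) hne

/-- The Sylow 3-subgroups fixed by `⟨x⟩` are those containing `x`, so their number is congruent to
10 modulo 3. It is not 10, because no nontrivial element lies in all of them. -/
theorem card_sylow_mem {x : G} {P : Sylow 3 G} (hx : x ∈ P) (h1 : x ≠ 1) :
    Nat.card {R : Sylow 3 G // x ∈ R} = 1 ∨ Nat.card {R : Sylow 3 G // x ∈ R} = 4 ∨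
      Nat.card {R : Sylow 3 G // x ∈ R} = 7 := by
  have hp := Sylow.isPGroup_zpowers hx
  have hfix : ∀ R : Sylow 3 G,
      R ∈ MulAction.fixedPoints (Subgroup.zpowers x) (Sylow 3 G) ↔ x ∈ R := fun R => by
    rw [hp.sylow_mem_fixedPoints_iff, Subgroup.zpowers_le]; rfl
  have hmod := hp.card_modEq_card_fixedPoints (Sylow 3 G)
  have hc : Nat.card (MulAction.fixedPoints (Subgroup.zpowers x) (Sylow 3 G)) =
      Nat.card {R : Sylow 3 G // x ∈ R} := Nat.card_congr (Equiv.subtypeEquivRight hfix)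
  rw [hc, hG.card_sylow_three] at hmod
  have hle : Nat.card {R : Sylow 3 G // x ∈ R} ≤ 10 := by
    rw [← hG.card_sylow_three]; exact Nat.card_le_card_of_injective _ Subtype.val_injective
  have hne : Nat.card {R : Sylow 3 G // x ∈ R} ≠ 10 := by
    intro h
    rw [← hG.card_sylow_three] at h
    have hb := Subtype.val_injective.bijective_of_nat_card_le h.ge
    refine h1 (hG.eq_one_of_forall_mem (p := 3) fun R => ?_)
    obtain ⟨y, rfl⟩ := hb.2 R
    exact y.2
  unfold Nat.ModEq at hmod
  omega

theorem orderOf_ne_of_mem {x : G} {P : Sylow 3 G} (hx : x ∈ P) : orderOf x ≠ 2 := by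
  intro h
  have := (P : Subgroup G).orderOf_dvd_natCard hx
  rw [h, show Nat.card (P : Subgroup G) = 9 from hG.card_sylow_coe_three P] at this
  norm_num at this

/-- Distinct Sylow `3`-subgroups meet trivially. -/
theorem eq_one_of_mem_of_mem {P P' : Sylow 3 G} (hne : P' ≠ P) {x : G} (hx : x ∈ P)
    (hx' : x ∈ P') : x = 1 := by
  classical
  by_contra hx1
  -- If one pair meets nontrivially then every pair does, in a subgroup of order 3. The
  -- contradiction comes from counting the elements `x ≠ 1` by the number `k x` of Sylow 3-subgroups
  -- containing them.
  have hnd : ∀ R R' : Sylow 3 G, R' ≠ R → ∃ y, y ∈ R ∧ y ∈ R' ∧ y ≠ 1 := by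
    intro R R' hR
    by_contra! hd
    exact hx1 (hG.eq_one_of_mem_of_disjoint hR hd hne hx hx')
  have := Fintype.ofFinite G
  have := Fintype.ofFinite (Sylow 3 G)
  let k : G → ℕ := fun x => Nat.card {R : Sylow 3 G // x ∈ R}
  have hkf : ∀ x, (Finset.univ.filter fun R : Sylow 3 G => x ∈ R).card = k x := fun x => by
    change _ = Nat.card _; rw [Nat.card_eq_fintype_card, Fintype.card_subtype]
  let m : ℕ → Sylow 3 G → ℕ := fun j R =>
    (Finset.univ.filter fun x : G => (x ≠ 1 ∧ k x = j) ∧ x ∈ R).card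
  let a : ℕ → ℕ := fun j => (Finset.univ.filter fun x : G => x ≠ 1 ∧ k x = j).card
  have hconst : ∀ j R, m j R = m j P := by
    intro j R
    obtain ⟨g, rfl⟩ := MulAction.exists_smul_eq G P R
    symm
    refine Finset.card_bij (fun x _ => g * x * g⁻¹) ?_ ?_ ?_
    · intro x hx
      simp only [Finset.mem_filter, Finset.mem_univ, true_and] at hx ⊢
      refine ⟨⟨by simpa using hx.1.1, ?_⟩, ?_⟩
      · rw [← hx.1.2]; exact card_sylow_mem_conj g x
      · rw [Sylow.mem_smul_iff]; simpa [mul_assoc] using hx.2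
    · intro x _ y _ h
      simpa using h
    · intro y hy
      simp only [Finset.mem_filter, Finset.mem_univ, true_and] at hy
      refine ⟨g⁻¹ * y * g, ?_, by group⟩
      simp only [Finset.mem_filter, Finset.mem_univ, true_and]
      refine ⟨⟨?_, ?_⟩, Sylow.mem_smul_iff.1 hy.2⟩
      · intro h
        apply hy.1.1
        rw [show y = g * (g⁻¹ * y * g) * g⁻¹ by group, h]; group
      · rw [← hy.1.2]
        have := card_sylow_mem_conj g⁻¹ y
        rwa [inv_inv] at this
  -- Double count of the pairs `x ∈ R` with `x ≠ 1` and `k x = j`.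
  have hdc : ∀ j, 10 * m j P = j * a j := by
    intro j
    have h1 := Finset.sum_card_bipartiteAbove_eq_sum_card_bipartiteBelow
      (fun (R : Sylow 3 G) (x : G) => x ∈ R) (s := Finset.univ)
      (t := Finset.univ.filter fun x : G => x ≠ 1 ∧ k x = j)
    have h2 : ∀ R : Sylow 3 G, (Finset.bipartiteAbove (fun (R : Sylow 3 G) (x : G) => x ∈ R)
        (Finset.univ.filter fun x : G => x ≠ 1 ∧ k x = j) R).card = m j P := by
      intro R
      rw [← hconst j R, Finset.bipartiteAbove, Finset.filter_filter]
    have h3 : ∀ x ∈ (Finset.univ.filter fun x : G => x ≠ 1 ∧ k x = j),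
        (Finset.bipartiteBelow (fun (R : Sylow 3 G) (x : G) => x ∈ R) Finset.univ x).card = j := by
      intro x hx
      rw [Finset.bipartiteBelow, hkf]
      simp only [Finset.mem_filter] at hx
      exact hx.2.2
    rw [Finset.sum_congr rfl fun R _ => h2 R, Finset.sum_congr rfl h3, Finset.sum_const,
      Finset.sum_const, Finset.card_univ, ← Nat.card_eq_fintype_card, hG.card_sylow_three] at h1
    simp only [smul_eq_mul] at h1
    rw [h1, mul_comm]
  let S : Finset G := Finset.univ.filter fun x : G => x ≠ 1 ∧ x ∈ P
  have hScard : ∀ H : Subgroup G, (Finset.univ.filter fun x : G => x ≠ 1 ∧ x ∈ H).card + 1 =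
      Nat.card H := by
    intro H
    rw [Nat.card_eq_fintype_card, Fintype.card_subtype,
      show (Finset.univ.filter fun x : G => x ≠ 1 ∧ x ∈ H) =
        (Finset.univ.filter fun x : G => x ∈ H).erase 1 by ext; simp,
      Finset.card_erase_add_one]
    simp [one_mem]
  have hS8 : S.card = 8 := by
    have := hScard P
    rw [show Nat.card (P : Subgroup G) = 9 from hG.card_sylow_coe_three P] at this
    exact Nat.succ_injective this
  have hvals : ∀ x ∈ S, k x ∈ ({1, 4, 7} : Finset ℕ) := by
    intro x hx
    simp only [S, Finset.mem_filter, Finset.mem_univ, true_and] at hx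
    have := hG.card_sylow_mem hx.2 hx.1
    simp only [Finset.mem_insert, Finset.mem_singleton]
    exact this
  have hm : ∀ j, (S.filter fun x => k x = j).card = m j P := by
    intro j
    simp only [S, m, Finset.filter_filter]
    congr 1; ext x; simp only [Finset.mem_filter]; tauto
  have hsum8 : m 1 P + m 4 P + m 7 P = 8 := by
    have := Finset.card_eq_sum_card_fiberwise (f := k) (s := S) (t := {1, 4, 7})
      (fun x hx => hvals x hx)
    rw [hS8] at this
    simp only [hm] at this
    rw [Finset.sum_insert (by simp), Finset.sum_insert (by simp), Finset.sum_singleton] at this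
    omega
  have hsumk : ∑ x ∈ S, k x = m 1 P + 4 * m 4 P + 7 * m 7 P := by
    rw [← Finset.sum_fiberwise_of_maps_to (t := {1, 4, 7}) (g := k) hvals]
    have : ∀ j ∈ ({1, 4, 7} : Finset ℕ), ∑ x ∈ S with k x = j, k x = j * m j P := by
      intro j _
      rw [Finset.sum_congr rfl (g := fun _ => j) fun x hx => (Finset.mem_filter.1 hx).2,
        Finset.sum_const, hm, smul_eq_mul, mul_comm]
    rw [Finset.sum_congr rfl this, Finset.sum_insert (by simp), Finset.sum_insert (by simp),
      Finset.sum_singleton]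
    ring
  -- `P` itself contributes 8, and each of the nine others contributes the 2 nontrivial elements of
  -- its intersection with `P`.
  have hsum26 : ∑ x ∈ S, k x = 26 := by
    have h1 := Finset.sum_card_bipartiteAbove_eq_sum_card_bipartiteBelow
      (fun (x : G) (R : Sylow 3 G) => x ∈ R) (s := S) (t := Finset.univ)
    simp only [Finset.bipartiteAbove, Finset.bipartiteBelow, hkf] at h1
    rw [h1, ← Finset.add_sum_erase _ _ (Finset.mem_univ P)]
    have h2 : (S.filter fun x => x ∈ P).card = 8 := by
      rw [← hS8]; congr 1; ext x; simp [S]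
    have h3 : ∀ R ∈ Finset.univ.erase P, (S.filter fun x => x ∈ R).card = 2 := by
      intro R hR
      obtain ⟨y, hy, hy', hy1⟩ := hnd P R (Finset.ne_of_mem_erase hR)
      have h4 := hG.card_inter (Finset.ne_of_mem_erase hR) hy hy' hy1
      rw [← hScard] at h4
      rw [show (S.filter fun x => x ∈ R) =
        (Finset.univ.filter fun x : G => x ≠ 1 ∧ x ∈ (P : Subgroup G) ⊓ R) from ?_]
      · omega
      · ext x
        simp only [S, Finset.mem_filter, Finset.mem_univ, true_and, and_assoc]
        rfl
    rw [h2, Finset.sum_congr rfl h3, Finset.sum_const, Finset.card_erase_of_mem (Finset.mem_univ _),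
      Finset.card_univ, ← Nat.card_eq_fintype_card, hG.card_sylow_three]
    rfl
  have ha4 : Even (a 4) := by
    have := even_card_filter_sylow_mem (G := G) 4
    convert this using 2
    ext x
    simp only [Finset.mem_filter, Finset.mem_univ, true_and, ne_eq, orderOf_eq_one_iff]
    refine ⟨fun h => ⟨h.1, ?_, h.2⟩, fun h => ⟨h.1, h.2.2⟩⟩
    have hpos : 0 < Nat.card {R : Sylow 3 G // x ∈ R} := by
      have : k x = 4 := h.2
      exact (by norm_num : 0 < 4).trans_eq this.symm
    obtain ⟨⟨R, hR⟩⟩ := (Nat.card_pos_iff.1 hpos).1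
    exact hG.orderOf_ne_of_mem hR
  -- The two sums give `m 4 P + 2 * m 7 P = 6`. As 7 divides `m 7 P`, this leaves `m 7 P = 0` and `m
  -- 4 P = 6`, so `a 4 = 15`, which is odd.
  have h4 := hdc 4
  have h7 := hdc 7
  obtain ⟨b, hb⟩ := ha4
  omega

end IsCoreFree360

/-! ### Sylow 5-subgroups and the absence of subgroups of index two -/

namespace IsCoreFree360

variable {G : Type*} [Group G] [Finite G] (hG : IsCoreFree360 G)
include hG

/-- If `x ∈ P` commutes with `y` then `x` lies in both `P` and `y • P`, so `y` normalizes `P`; but 5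
does not divide 36. -/
theorem not_commute_of_orderOf {x y : G} (hx : orderOf x = 3) (hy : orderOf y = 5) :
    ¬ Commute x y := by
  intro h
  obtain ⟨P, hP⟩ := (isPGroup_zpowers_of_orderOf hx).exists_le_sylow
  have hxP : x ∈ P := hP (Subgroup.mem_zpowers x)
  have hxy : x ∈ y • P := by
    rw [Sylow.mem_smul_iff, mul_assoc, h.eq, inv_mul_cancel_left]; exact hxP
  have hyP : y • P = P := by
    by_contra hne
    have := hG.eq_one_of_mem_of_mem hne hxP hxy
    rw [this, orderOf_one] at hx
    norm_num at hx
  have := (MulAction.stabilizer G P).orderOf_dvd_natCard (MulAction.mem_stabilizer_iff.2 hyP)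
  rw [hG.card_stabilizer, hy] at this
  norm_num at this

/-- Six Sylow 5-subgroups would have normalizers of order 60. An element of order 3 there acts
trivially on `C₅`, whose automorphism group has order 4, and so commutes with an element of order 5.
-/
theorem card_sylow_five_eq : Nat.card (Sylow 5 G) = 36 := by
  have : Fact (Nat.Prime 5) := ⟨by norm_num⟩
  refine hG.card_sylow_five.resolve_left fun h6 => ?_
  let P : Sylow 5 G := default
  have h5 : Nat.card (P : Subgroup G) = 5 := hG.card_sylow_coe_five P
  have hN : Nat.card (Subgroup.normalizer ((P : Subgroup G) : Set G)) = 60 := by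
    have h1 := P.card_eq_index_normalizer
    have h2 := Subgroup.card_mul_index (Subgroup.normalizer ((P : Subgroup G) : Set G))
    rw [h6] at h1
    rw [show (Subgroup.normalizer ((P : Subgroup G) : Set G)).index = 6 from h1.symm,
      hG.card_eq] at h2
    omega
  obtain ⟨y, hy⟩ := exists_prime_orderOf_dvd_card' (G := Subgroup.normalizer ((P : Subgroup G) : Set G))
    3 (by rw [hN]; norm_num)
  obtain ⟨z, hz⟩ := exists_prime_orderOf_dvd_card' (G := (P : Subgroup G)) 5 (by rw [h5])
  have hcyc : IsCyclic (P : Subgroup G) := isCyclic_of_prime_card h5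
  let α := (P : Subgroup G).normalizerMonoidHom y
  have h4 : orderOf α ∣ 4 := by
    have := IsCyclic.card_mulAut (P : Subgroup G)
    rw [h5, show Nat.totient 5 = 4 by decide] at this
    rw [← this]
    exact orderOf_dvd_natCard α
  have h3 : orderOf α ∣ 3 := by
    rw [← hy]; exact orderOf_map_dvd _ y
  have h1 : α = 1 := by
    rw [← orderOf_eq_one_iff]
    exact Nat.eq_one_of_dvd_coprimes (by norm_num : Nat.Coprime 3 4) h3 h4
  have h2 : ((α z : (P : Subgroup G)) : G) = y * z * (y : G)⁻¹ := rfl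
  rw [h1] at h2
  refine hG.not_commute_of_orderOf (x := (y : G)) (y := (z : G))
    ((Subgroup.orderOf_coe y).trans hy) ((Subgroup.orderOf_coe z).trans hz) ?_
  exact (eq_mul_inv_iff_mul_eq.1 h2).symm

theorem eq_one_of_mem_of_mem_five {P P' : Sylow 5 G} (hne : P' ≠ P) {x : G} (hx : x ∈ P)
    (hx' : x ∈ P') : x = 1 := by
  by_contra h1
  have hz : Nat.card (Subgroup.zpowers x) = 5 := by
    have h5 := (P : Subgroup G).orderOf_dvd_natCard hx
    rw [show Nat.card (P : Subgroup G) = 5 from hG.card_sylow_coe_five P,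
      Nat.dvd_prime (by norm_num), orderOf_eq_one_iff] at h5
    rw [Nat.card_zpowers]
    exact h5.resolve_left h1
  have key : ∀ R : Sylow 5 G, x ∈ R → Subgroup.zpowers x = R := fun R hR =>
    Subgroup.eq_of_le_of_card_ge (Subgroup.zpowers_le.2 hR)
      (by rw [hz]; exact (hG.card_sylow_coe_five R).le)
  exact hne (Sylow.ext ((key P' hx').symm.trans (key P hx)))

/-- Every homomorphism from `G` to a group of order two is trivial. -/
theorem hom_eq_one (f : G →* ℤˣ) (g : G) : f g = 1 := by
  have hodd : ∀ (H : Subgroup G), Odd (Nat.card H) → ∀ x ∈ H, x ∈ f.ker := by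
    intro H hH x hx
    rw [MonoidHom.mem_ker]
    refine (Int.units_eq_one_or (f x)).resolve_right fun h => ?_
    have h1 : x ^ Nat.card H = 1 := by
      have := pow_card_eq_one' (x := (⟨x, hx⟩ : H))
      exact congrArg Subtype.val this
    have h2 := map_pow f x (Nat.card H)
    rw [h1, map_one, h, hH.neg_one_pow] at h2
    exact absurd h2 (by decide)
  have hcard : ∀ {p m : ℕ}, (∀ P : Sylow p G, Nat.card (P : Subgroup G) = m + 1) →
      Nat.card (Σ P : Sylow p G, {x : (P : Subgroup G) // x ≠ 1}) = Nat.card (Sylow p G) * m := by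
    intro p m h
    have := Fintype.ofFinite (Sylow p G)
    rw [Nat.card_sigma]
    have h1 : ∀ P : Sylow p G, Nat.card {x : (P : Subgroup G) // x ≠ 1} = m := by
      classical
      intro P
      have := Fintype.ofFinite (P : Subgroup G)
      have h2 := h P
      rw [Nat.card_eq_fintype_card] at h2 ⊢
      rw [Fintype.card_subtype_compl, Fintype.card_subtype_eq, h2]
      rfl
    rw [Finset.sum_congr rfl fun P _ => h1 P, Finset.sum_const, Finset.card_univ,
      Nat.card_eq_fintype_card, smul_eq_mul]
  have h3 := hcard (p := 3) (m := 8) hG.card_sylow_coe_three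
  have h5 := hcard (p := 5) (m := 4) hG.card_sylow_coe_five
  rw [hG.card_sylow_three] at h3
  rw [hG.card_sylow_five_eq] at h5
  -- Elements of odd order lie in the kernel. The Sylow 3- and 5-subgroups supply `10 * 8 + 36 * 4 =
  -- 224` of them, more than half of 360.
  let F : (Σ P : Sylow 3 G, {x : (P : Subgroup G) // x ≠ 1}) ⊕
      (Σ P : Sylow 5 G, {x : (P : Subgroup G) // x ≠ 1}) → f.ker :=
    Sum.elim
      (fun y => ⟨y.2.1, hodd y.1 (by
        rw [show Nat.card (y.1 : Subgroup G) = 9 from hG.card_sylow_coe_three y.1]; decide)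
        _ y.2.1.2⟩)
      (fun y => ⟨y.2.1, hodd y.1 (by
        rw [show Nat.card (y.1 : Subgroup G) = 5 from hG.card_sylow_coe_five y.1]; decide)
        _ y.2.1.2⟩)
  have hF : Function.Injective F := by
    refine Function.Injective.sumElim ?_ ?_ ?_
    · rintro ⟨P, x, hx⟩ ⟨P', x', hx'⟩ h
      have h1 : (x : G) = x' := congrArg Subtype.val h
      have hP : P' = P := by
        by_contra hne
        exact hx (Subtype.ext (hG.eq_one_of_mem_of_mem hne x.2 (h1 ▸ x'.2)))
      subst hP
      have : x = x' := Subtype.ext h1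
      subst this
      rfl
    · rintro ⟨P, x, hx⟩ ⟨P', x', hx'⟩ h
      have h1 : (x : G) = x' := congrArg Subtype.val h
      have hP : P' = P := by
        by_contra hne
        exact hx (Subtype.ext (hG.eq_one_of_mem_of_mem_five hne x.2 (h1 ▸ x'.2)))
      subst hP
      have : x = x' := Subtype.ext h1
      subst this
      rfl
    · rintro ⟨P, x, hx⟩ ⟨P', x', hx'⟩ h
      have h1 : (x : G) = x' := congrArg Subtype.val h
      have d1 := (P : Subgroup G).orderOf_dvd_natCard x.2
      have d2 := (P' : Subgroup G).orderOf_dvd_natCard x'.2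
      rw [show Nat.card (P : Subgroup G) = 9 from hG.card_sylow_coe_three P] at d1
      rw [show Nat.card (P' : Subgroup G) = 5 from hG.card_sylow_coe_five P', ← h1] at d2
      have := Nat.eq_one_of_dvd_coprimes (by norm_num : Nat.Coprime 9 5) d1 d2
      exact hx (Subtype.ext (orderOf_eq_one_iff.1 this))
  have hle := Nat.card_le_card_of_injective F hF
  rw [Nat.card_sum, h3, h5] at hle
  have hmul := f.ker.card_mul_index
  rw [hG.card_eq] at hmul
  have hidx : f.ker.index = 1 := by
    have : f.ker.index ≠ 0 := fun h => by rw [h] at hmul; omega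
    by_contra hne
    have h2 : 2 ≤ f.ker.index := by omega
    nlinarith
  rw [← MonoidHom.mem_ker, Subgroup.index_eq_one.1 hidx]
  exact Subgroup.mem_top g

end IsCoreFree360

/-! ### The stabilizer of two points -/

theorem Sylow.conj_mem_of_smul_eq {G : Type*} [Group G] {p : ℕ} {P : Sylow p G} {g x : G}
    (hg : g • P = P) (hx : x ∈ P) : g * x * g⁻¹ ∈ P := by
  have : g * x * g⁻¹ ∈ g • P := by rw [Sylow.mem_smul_iff]; simpa [mul_assoc] using hx
  rwa [hg] at this

namespace IsCoreFree360

variable {G : Type*} [Group G] [Finite G] (hG : IsCoreFree360 G)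
variable {P P' : Sylow 3 G} (hne : P' ≠ P)
include hG hne

theorem exists_mem_smul_eq {R : Sylow 3 G} (hR : R ≠ P) : ∃ q ∈ P, q • P' = R :=
  hG.exists_smul_eq_of_disjoint hne (fun _ hx hx' => hG.eq_one_of_mem_of_mem hne hx hx') hR

theorem eq_of_smul_eq_smul {q r : G} (hq : q ∈ P) (hr : r ∈ P) (h : q • P' = r • P') : q = r := by
  have h2 : (r⁻¹ * q) • P' = P' := by rw [mul_smul, h, inv_smul_smul]
  have h3 : r⁻¹ * q ∈ P := mul_mem (inv_mem hr) hq
  exact (inv_mul_eq_one.1 (hG.eq_one_of_mem_of_mem hne h3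
    (Sylow.mem_of_isPGroup_zpowers (Sylow.isPGroup_zpowers h3) h2))).symm

omit [Finite G] hG in
theorem smul_ne_of_mem {q : G} (hq : q ∈ P) : q • P' ≠ P := fun h =>
  hne (smul_left_cancel q (h.trans (Sylow.smul_eq_of_mem hq).symm))

/-- Since `P` is regular on the remaining points, the normalizer of `P` factors uniquely as `P`
times the two-point stabilizer, and `36 / 9 = 4`. -/
theorem card_stabilizer_inf :
    Nat.card (MulAction.stabilizer G P ⊓ MulAction.stabilizer G P' : Subgroup G) = 4 := by
  let C : Subgroup G := MulAction.stabilizer G P ⊓ MulAction.stabilizer G P'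
  let f : P × C → MulAction.stabilizer G P := fun y =>
    ⟨y.1 * y.2, mul_mem (MulAction.mem_stabilizer_iff.2 (Sylow.smul_eq_of_mem y.1.2)) y.2.2.1⟩
  have hf : Function.Bijective f := by
    constructor
    · rintro ⟨q, c⟩ ⟨q', c'⟩ h
      have h1 : (q : G) * c = q' * c' := congrArg Subtype.val h
      have hc : (c : G) • P' = P' := c.2.2
      have hc' : (c' : G) • P' = P' := c'.2.2
      have h2 : (q : G) • P' = (q' : G) • P' := by
        rw [← hc, ← mul_smul, h1, mul_smul, hc', hc]
      have h3 := hG.eq_of_smul_eq_smul hne q.2 q'.2 h2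
      rw [h3] at h1
      exact Prod.ext (Subtype.ext h3) (Subtype.ext (mul_left_cancel h1))
    · rintro ⟨b, hb⟩
      have hb' : b • P = P := hb
      have hbP : b • P' ≠ P := fun h => hne (smul_left_cancel b (h.trans hb'.symm))
      obtain ⟨q, hq, h⟩ := hG.exists_mem_smul_eq hne hbP
      have hqs : q ∈ MulAction.stabilizer G P := Sylow.smul_eq_of_mem hq
      refine ⟨⟨⟨q, hq⟩, ⟨q⁻¹ * b, (MulAction.stabilizer G P).mul_mem (inv_mem hqs) hb, ?_⟩⟩, Subtype.ext ?_⟩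
      · change (q⁻¹ * b) • P' = P'
        rw [mul_smul, ← h, inv_smul_smul]
      · exact mul_inv_cancel_left q b
  have := Nat.card_congr (Equiv.ofBijective f hf)
  rw [Nat.card_prod, hG.card_stabilizer, hG.card_sylow_coe_three] at this
  change Nat.card C = 4
  omega

theorem eq_one_of_commute {s : G} (hs : s • P = P) (hs' : s • P' = P')
    (h : ∀ q ∈ P, s * q = q * s) : s = 1 := by
  refine hG.eq_one_of_forall_smul_eq fun R => ?_
  by_cases hR : R = P
  · rw [hR, hs]
  · obtain ⟨q, hq, rfl⟩ := hG.exists_mem_smul_eq hne hR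
    rw [← mul_smul, h q hq, mul_smul, hs']

/-- Under `q ↦ q • P'` the action of `s` on the points other than `P` becomes conjugation on `P`;
the extra 1 counts the point `P`. -/
theorem card_fixedPoints {s : G} (hs : s • P = P) (hs' : s • P' = P') :
    Nat.card (Function.fixedPoints (MulAction.toPermHom G (Sylow 3 G) s)) =
      Nat.card ((P : Subgroup G) ⊓ Subgroup.centralizer {s} : Subgroup G) + 1 := by
  have hcent : ∀ q ∈ P, s • q • P' = q • P' ↔ q ∈ Subgroup.centralizer {s} := by
    intro q hq
    rw [Subgroup.mem_centralizer_singleton_iff]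
    constructor
    · intro h
      have h1 : (s * q * s⁻¹) • P' = q • P' := by
        rw [mul_smul, mul_smul, inv_smul_eq_iff.2 hs'.symm, h]
      have := hG.eq_of_smul_eq_smul hne (Sylow.conj_mem_of_smul_eq hs hq) hq h1
      exact (mul_inv_eq_iff_eq_mul.1 this).symm
    · intro h
      rw [← mul_smul, ← h, mul_smul, hs']
  rw [← Finite.card_option]
  let f : Option ((P : Subgroup G) ⊓ Subgroup.centralizer {s} : Subgroup G) →
      Function.fixedPoints (MulAction.toPermHom G (Sylow 3 G) s) := fun o =>
    o.elim ⟨P, hs⟩ (fun q => ⟨(q : G) • P', (hcent q q.2.1).2 q.2.2⟩)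
  refine (Nat.card_congr (Equiv.ofBijective f ⟨?_, ?_⟩)).symm
  · rintro (_ | q) (_ | r) h
    · rfl
    · exact absurd (congrArg Subtype.val h).symm (smul_ne_of_mem hne r.2.1)
    · exact absurd (congrArg Subtype.val h) (smul_ne_of_mem hne q.2.1)
    · exact congrArg some (Subtype.ext
        (hG.eq_of_smul_eq_smul hne q.2.1 r.2.1 (congrArg Subtype.val h)))
  · rintro ⟨R, hR⟩
    by_cases h : R = P
    · exact ⟨none, Subtype.ext h.symm⟩
    · obtain ⟨q, hq, rfl⟩ := hG.exists_mem_smul_eq hne h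
      exact ⟨some ⟨q, hq, (hcent q hq).1 hR⟩, rfl⟩

/-- The involution `s` has 2, 4 or 10 fixed points. Four would make it a product of three
transpositions, which is odd, against `hom_eq_one`; ten would make it trivial. So `s` centralizes
nothing in `P` but 1, whereas it does centralize `q * (s * q * s⁻¹)`, because `P` is abelian. -/
theorem conj_eq_inv_of_sq_eq_one {s : G} (hs : s • P = P) (hs' : s • P' = P') (h2 : s ^ 2 = 1)
    (h1 : s ≠ 1) {q : G} (hq : q ∈ P) : s * q * s⁻¹ = q⁻¹ := by
  classical
  have := Fintype.ofFinite (Sylow 3 G)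
  have hcard := hG.card_fixedPoints hne hs hs'
  have hsign := hG.hom_eq_one (Equiv.Perm.sign.comp (MulAction.toPermHom G (Sylow 3 G))) s
  rw [MonoidHom.comp_apply, Equiv.Perm.sign_of_pow_two_eq_one (by rw [← map_pow, h2, map_one]),
    ← Nat.card_eq_fintype_card, ← Nat.card_eq_fintype_card, hG.card_sylow_three, hcard] at hsign
  have hd := Subgroup.card_dvd_of_le
    (inf_le_left : (P : Subgroup G) ⊓ Subgroup.centralizer {s} ≤ P)
  have h9 : Nat.card (P : Subgroup G) = 9 := hG.card_sylow_coe_three P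
  rw [h9, show 9 = 3 ^ 2 by norm_num, Nat.dvd_prime_pow Nat.prime_three] at hd
  have hbot : (P : Subgroup G) ⊓ Subgroup.centralizer {s} = ⊥ := by
    obtain ⟨k, hk, hkc⟩ := hd
    interval_cases k
    · exact Subgroup.card_eq_one.1 (by simpa using hkc)
    · rw [hkc] at hsign
      exact absurd hsign (by decide)
    · have e := Subgroup.eq_of_le_of_card_ge
        (inf_le_left : (P : Subgroup G) ⊓ Subgroup.centralizer {s} ≤ P)
        (by rw [hkc, h9]; norm_num)
      refine absurd (hG.eq_one_of_commute hne hs hs' fun q hq => ?_) h1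
      have hq' : q ∈ (P : Subgroup G) := hq
      rw [← e] at hq'
      exact (Subgroup.mem_centralizer_singleton_iff.1 hq'.2).symm
  have hsq := Sylow.conj_mem_of_smul_eq hs hq
  have hss : s * s = 1 := by rw [← pow_two, h2]
  have hsi : s⁻¹ = s := inv_eq_of_mul_eq_one_left hss
  have hmem : q * (s * q * s⁻¹) ∈ (P : Subgroup G) ⊓ Subgroup.centralizer {s} := by
    refine ⟨mul_mem hq hsq, Subgroup.mem_centralizer_singleton_iff.2 ?_⟩
    have hc := hG.mul_comm_of_mem hq hsq
    rw [hsi] at hc ⊢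
    calc q * (s * q * s) * s = q * (s * q) * (s * s) := by group
      _ = (s * s) * q * (s * q) := by rw [hss]; group
      _ = s * ((s * q * s) * q) := by group
      _ = s * (q * (s * q * s)) := by rw [hc]
  rw [hbot, Subgroup.mem_bot] at hmem
  exact (inv_eq_of_mul_eq_one_right hmem).symm

/-- The pointwise stabilizer of two points is cyclic of order four. -/
theorem exists_orderOf_eq_four : ∃ c : G, c • P = P ∧ c • P' = P' ∧ orderOf c = 4 := by
  by_contra! hno
  let C : Subgroup G := MulAction.stabilizer G P ⊓ MulAction.stabilizer G P'
  have hC : Nat.card C = 4 := hG.card_stabilizer_inf hne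
  have hsq : ∀ c ∈ C, c ^ 2 = 1 := by
    intro c hc
    have h1 := C.orderOf_dvd_natCard hc
    rw [hC, show 4 = 2 ^ 2 by norm_num, Nat.dvd_prime_pow Nat.prime_two] at h1
    obtain ⟨k, hk, hk'⟩ := h1
    refine orderOf_dvd_iff_pow_eq_one.1 ?_
    interval_cases k
    · rw [hk']; norm_num
    · rw [hk']; norm_num
    · exact absurd (by simpa using hk') (hno c hc.1 hc.2)
  -- Two involutions of `C` both invert `P`, so their product centralizes `P` and is trivial.
  have huniq : ∀ s ∈ C, ∀ r ∈ C, s ≠ 1 → r ≠ 1 → s = r := by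
    intro s hs r hr hs1 hr1
    have hr2 := hsq r hr
    rw [pow_two] at hr2
    have : s * r = 1 := by
      have hm := mul_mem hs hr
      refine hG.eq_one_of_commute hne hm.1 hm.2 fun q hq => ?_
      have e1 := hG.conj_eq_inv_of_sq_eq_one hne hr.1 hr.2 (hsq r hr) hr1 hq
      have e2 := hG.conj_eq_inv_of_sq_eq_one hne hs.1 hs.2 (hsq s hs) hs1 (inv_mem hq)
      rw [inv_inv, ← e1] at e2
      calc s * r * q = (s * (r * q * r⁻¹) * s⁻¹) * (s * r) := by group
        _ = q * (s * r) := by rw [e2]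
    rw [← eq_inv_iff_mul_eq_one, inv_eq_of_mul_eq_one_left hr2] at this
    exact this
  have hle : Nat.card C ≤ 2 := by
    let f : C → Bool := fun c => @decide (c = 1) (Classical.dec _)
    have hf : Function.Injective f := by
      intro a b hab
      by_cases ha : a = 1 <;> by_cases hb : b = 1
      · rw [ha, hb]
      · simp [f, ha, hb] at hab
      · simp [f, ha, hb] at hab
      · exact Subtype.ext (huniq a a.2 b b.2 (fun h => ha (Subtype.ext h))
          (fun h => hb (Subtype.ext h)))
    simpa using Nat.card_le_card_of_injective f hf
  omega

theorem exists_pow_eq {c : G} (hc : c • P = P) (hc' : c • P' = P') (h4 : orderOf c = 4) {s : G}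
    (hs : s • P = P) (hs' : s • P' = P') : ∃ j < 4, s = c ^ j := by
  let C : Subgroup G := MulAction.stabilizer G P ⊓ MulAction.stabilizer G P'
  have hcC : c ∈ C := ⟨hc, hc'⟩
  have hsC : s ∈ C := ⟨hs, hs'⟩
  have hz : Subgroup.zpowers c = C := Subgroup.eq_of_le_of_card_ge (Subgroup.zpowers_le.2 hcC)
    (by rw [Nat.card_zpowers, h4]; exact (hG.card_stabilizer_inf hne).le)
  rw [← hz] at hsC
  classical
  obtain ⟨j, hj, h⟩ := Finset.mem_image.1 (mem_zpowers_iff_mem_range_orderOf.1 hsC)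
  exact ⟨j, by rw [← h4]; exact Finset.mem_range.1 hj, h.symm⟩

/-- Some element of `G` interchanges the two points. -/
theorem exists_swap : ∃ t : G, t • P = P' ∧ t • P' = P := by
  obtain ⟨g, hg⟩ := MulAction.exists_smul_eq G P P'
  have h1 : g • P' ≠ P' := fun h => hne (smul_left_cancel g (h.trans hg.symm))
  obtain ⟨q, hq, h⟩ := hG.exists_mem_smul_eq hne.symm h1
  refine ⟨q⁻¹ * g, ?_, ?_⟩
  · rw [mul_smul, hg, Sylow.smul_eq_of_mem (inv_mem hq)]
  · rw [mul_smul, ← h, inv_smul_smul]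

end IsCoreFree360

/-! ### Uniqueness of the permutation group on the projective line -/

/-- The affine plane over the field with three elements. -/
abbrev Plane : Type := ZMod 3 × ZMod 3

namespace Plane

/-- The quarter turn of the plane. -/
def rot : Equiv.Perm Plane where
  toFun v := (-v.2, v.1)
  invFun v := (v.2, -v.1)
  left_inv v := by simp
  right_inv v := by simp

/-- Translations of the plane, fixing the point at infinity. -/
def translPerm (v : Plane) : Equiv.Perm (Option Plane) := (Equiv.addLeft v).optionCongr

/-- The quarter turn of the plane, fixing the point at infinity. -/
def rotPerm : Equiv.Perm (Option Plane) := rot.optionCongr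

@[simp] theorem translPerm_none (v : Plane) : translPerm v none = none := rfl
@[simp] theorem translPerm_some (v w : Plane) : translPerm v (some w) = some (v + w) := rfl
@[simp] theorem rotPerm_none : rotPerm none = none := rfl
@[simp] theorem rotPerm_some (w : Plane) : rotPerm (some w) = some (rot w) := rfl

theorem rotPerm_pow_apply (j : ℕ) (p : Option Plane) :
    (rotPerm ^ j) p = p.map rot^[j] := by
  induction j with
  | zero => simp
  | succ j ih =>
    rw [pow_succ', Equiv.Perm.mul_apply, ih, Function.iterate_succ']
    cases p <;> rfl

/-- The map of the projective line that interchanges `0` and infinity, takes `(1, 0)` to `x` and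
`(1, 1)` to `y`, and intertwines the quarter turn with its `j`-th power. -/
def swapFun (j : ℕ) (x y : Plane) : Option Plane → Option Plane
  | none => some 0
  | some v =>
    if v = (0, 0) then none
    else if v = (1, 0) then some x
    else if v = (0, 1) then some (rot^[j] x)
    else if v = (2, 0) then some (rot^[j] (rot^[j] x))
    else if v = (0, 2) then some (rot^[j] (rot^[j] (rot^[j] x)))
    else if v = (1, 1) then some y
    else if v = (2, 1) then some (rot^[j] y)
    else if v = (2, 2) then some (rot^[j] (rot^[j] y))
    else some (rot^[j] (rot^[j] (rot^[j] y)))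

/-- Inversion in the field of nine elements, on the projective line. -/
def invFun : Option Plane → Option Plane := swapFun 3 (1, 0) (2, 1)

/-- For `f` interchanging `0` and infinity, a product of copies of `f` with translations that fixes
both `0` and infinity. -/
def triple (f : Option Plane → Option Plane) (x : Plane) (p : Option Plane) : Option Plane :=
  translPerm (-(f (some (-x))).getD 0) (f (translPerm (-x) (f (translPerm (1, 0) (f p)))))

/-- A finite check over the `4 * 9 * 9` candidates. The parameters of `invFun` record `1/(iz) =
i³/z`, `1/1 = 1` and `1/(1 + i) = 2 + i`. -/
theorem swapFun_eq_of_triple : ∀ (j : Fin 4) (x y : Plane),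
    (∃ i : Fin 4, ∀ p, triple (swapFun j x y) x p = p.map rot^[i]) →
      ∃ i : Fin 4, ∀ p, swapFun j x y p = (invFun p).map rot^[i] := by
  decide +kernel

/-- The nonzero vectors form two orbits under the quarter turn, those of `(1, 0)` and `(1, 1)`. -/
theorem eq_swapFun {f : Option Plane → Option Plane} {j : ℕ} {x y : Plane}
    (hnone : f none = some 0) (hzero : f (some 0) = none) (hx : f (some (1, 0)) = some x)
    (hy : f (some (1, 1)) = some y) (hrot : ∀ p, f (rotPerm p) = (f p).map rot^[j])
    (p : Option Plane) : f p = swapFun j x y p := by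
  have h1 : f (some (0, 1)) = some (rot^[j] x) := by
    have := hrot (some (1, 0)); rwa [hx] at this
  have h2 : f (some (2, 0)) = some (rot^[j] (rot^[j] x)) := by
    have := hrot (some (0, 1)); rwa [h1] at this
  have h3 : f (some (0, 2)) = some (rot^[j] (rot^[j] (rot^[j] x))) := by
    have := hrot (some (2, 0)); rwa [h2] at this
  have h4 : f (some (2, 1)) = some (rot^[j] y) := by
    have := hrot (some (1, 1)); rwa [hy] at this
  have h5 : f (some (2, 2)) = some (rot^[j] (rot^[j] y)) := by
    have := hrot (some (2, 1)); rwa [h4] at this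
  have h6 : f (some (1, 2)) = some (rot^[j] (rot^[j] (rot^[j] y))) := by
    have := hrot (some (2, 2)); rwa [h5] at this
  rcases p with _ | ⟨a, b⟩
  · exact hnone
  · fin_cases a <;> fin_cases b
    exacts [hzero, h1, h3, hx, hy, h6, h2, h4, h5]

/-- Groups of permutations of the projective line that contain the translations, the quarter turn
and a permutation interchanging `0` and infinity, in which only the powers of the quarter turn fix
`0` and infinity. -/
structure IsZassenhaus (H : Subgroup (Equiv.Perm (Option Plane))) : Prop where
  transl_mem : ∀ v, translPerm v ∈ H
  rot_mem : rotPerm ∈ H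
  exists_swap : ∃ T ∈ H, T none = some 0 ∧ T (some 0) = none
  eq_pow : ∀ h ∈ H, h none = none → h (some 0) = some 0 → ∃ j < 4, h = rotPerm ^ j

namespace IsZassenhaus

variable {H K : Subgroup (Equiv.Perm (Option Plane))}

theorem exists_inv (hH : IsZassenhaus H) : ∃ T ∈ H, ⇑T = invFun := by
  obtain ⟨T, hT, hT0, hT1⟩ := hH.exists_swap
  -- `T` interchanges 0 and infinity, so it normalizes the group of powers of the quarter turn.
  obtain ⟨j, hj, hjT⟩ := hH.eq_pow (T * rotPerm * T⁻¹)
    (mul_mem (mul_mem hT hH.rot_mem) (inv_mem hT))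
    (by simp only [Equiv.Perm.mul_apply]; rw [Equiv.Perm.inv_eq_iff_eq.2 hT1.symm]; exact hT1)
    (by simp only [Equiv.Perm.mul_apply]; rw [Equiv.Perm.inv_eq_iff_eq.2 hT0.symm]; exact hT0)
  have hrot : ∀ p, T (rotPerm p) = (T p).map rot^[j] := by
    intro p
    rw [← rotPerm_pow_apply, ← hjT]
    simp
  have hsome : ∀ v : Plane, v ≠ 0 → ∃ x, T (some v) = some x := by
    intro v hv
    rw [← Option.ne_none_iff_exists']
    intro h
    exact hv (Option.some.inj (T.injective (h.trans hT1.symm)))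
  obtain ⟨x, hx⟩ := hsome (1, 0) (by decide)
  obtain ⟨y, hy⟩ := hsome (1, 1) (by decide)
  have hx0 : x ≠ 0 := by
    rintro rfl
    exact absurd (T.injective (hx.trans hT0.symm)) (by simp)
  -- As `x ≠ 0`, the image of `-x` is finite, and the default value in `triple` is not used.
  obtain ⟨z, hz⟩ := hsome (-x) (neg_ne_zero.2 hx0)
  have hTf : ⇑T = swapFun j x y := funext (eq_swapFun hT0 hT1 hx hy hrot)
  -- The translations are chosen so that infinity goes to 0, `(1, 0)`, `x`, 0, infinity, and 0 goes
  -- to infinity, 0, `-x`, `z`, 0. Hence `h` is a power of the quarter turn, which is the condition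
  -- that pins down `T`.
  let h := translPerm (-z) * T * translPerm (-x) * T * translPerm (1, 0) * T
  have hh : ∀ p, h p = triple (swapFun j x y) x p := by
    intro p
    rw [← hTf, triple, hz]
    rfl
  obtain ⟨i, hi, hhi⟩ := hH.eq_pow h
    (mul_mem (mul_mem (mul_mem (mul_mem (mul_mem (hH.transl_mem _) hT) (hH.transl_mem _)) hT)
      (hH.transl_mem _)) hT)
    (by
      have e : ((1, 0) : Plane) + 0 = (1, 0) := by decide
      simp [h, hT0, e, hx, hT1])
    (by simp [h, hT0, hT1, hz])
  obtain ⟨k, hk⟩ := swapFun_eq_of_triple ⟨j, hj⟩ x y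
    ⟨⟨i, hi⟩, fun p => by rw [← rotPerm_pow_apply, ← hhi]; exact (hh p).symm⟩
  refine ⟨(rotPerm ^ (k : ℕ))⁻¹ * T, mul_mem (inv_mem (pow_mem hH.rot_mem _)) hT, funext fun p => ?_⟩
  rw [Equiv.Perm.mul_apply, Equiv.Perm.inv_eq_iff_eq, rotPerm_pow_apply, ← hk, hTf]

/-- Both groups contain the same inversion. Composing with it and with translations reduces any
element of `H` to one fixing 0 and infinity, that is, to a power of the quarter turn, without
leaving `K`. -/
theorem le (hH : IsZassenhaus H) (hK : IsZassenhaus K) : H ≤ K := by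
  obtain ⟨T, hT, hTf⟩ := hH.exists_inv
  obtain ⟨T', hT', hTf'⟩ := hK.exists_inv
  obtain rfl : T = T' := DFunLike.coe_injective (hTf.trans hTf'.symm)
  have hT0 : T none = some 0 := by rw [hTf]; rfl
  have hT1 : T (some 0) = none := by rw [hTf]; decide
  have key : ∀ h ∈ H, h none = none → h ∈ K := by
    intro h hh h0
    have hne : h (some 0) ≠ none := fun h1 => by
      have := h.injective (h1.trans h0.symm)
      simp at this
    obtain ⟨w, hw⟩ := Option.ne_none_iff_exists'.1 hne
    obtain ⟨j, -, hj⟩ := hH.eq_pow (translPerm (-w) * h) (mul_mem (hH.transl_mem _) hh)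
      (by simp [h0]) (by simp [hw])
    rw [← inv_mul_cancel_left (translPerm (-w)) h, hj]
    exact mul_mem (inv_mem (hK.transl_mem _)) (pow_mem hK.rot_mem _)
  intro h hh
  rcases hv : h none with _ | v
  · exact key h hh hv
  · have := key (T * translPerm (-v) * h) (mul_mem (mul_mem hT (hH.transl_mem _)) hh)
      (by simp [hv, hT1])
    rw [← inv_mul_cancel_left (T * translPerm (-v)) h]
    exact mul_mem (inv_mem (mul_mem hT' (hK.transl_mem _))) this

theorem eq (hH : IsZassenhaus H) (hK : IsZassenhaus K) : H = K :=
  le_antisymm (hH.le hK) (hK.le hH)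

end IsZassenhaus

end Plane

/-! ### Coordinates on the ten points -/

theorem pow_zmod_val_add {M : Type*} [Monoid M] {x : M} {n : ℕ} [NeZero n] (hx : x ^ n = 1)
    (a b : ZMod n) : x ^ (a + b).val = x ^ a.val * x ^ b.val := by
  rw [ZMod.val_add, ← pow_add, ← pow_eq_pow_mod _ hx]

theorem inv_pow_zmod_val {M : Type*} [Group M] {x : M} {n : ℕ} [NeZero n] (hx : x ^ n = 1)
    (a : ZMod n) : x⁻¹ ^ a.val = x ^ (-a).val := by
  rw [inv_pow, inv_eq_iff_mul_eq_one, ← pow_zmod_val_add hx, add_neg_cancel, ZMod.val_zero,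
    pow_zero]

namespace IsCoreFree360

open Plane

variable {G : Type*} [Group G] [Finite G] (hG : IsCoreFree360 G)
include hG

/-- The Sylow `3`-subgroup `P` is coordinatized by the plane, in such a way that `c` acts as a
quarter turn. -/
theorem exists_coordinates {P P' : Sylow 3 G} (hne : P' ≠ P) {c : G} (hc : c • P = P)
    (hc' : c • P' = P') (h4 : orderOf c = 4) :
    ∃ u : Plane → G, Function.Injective u ∧ (∀ v, u v ∈ P) ∧ (∀ v w, u (v + w) = u v * u w) ∧
      ∀ v, c * u v * c⁻¹ = u (rot v) := by
  obtain ⟨z, hz⟩ := exists_prime_orderOf_dvd_card' (G := (P : Subgroup G)) 3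
    (by rw [show Nat.card (P : Subgroup G) = 9 from hG.card_sylow_coe_three P]; norm_num)
  obtain ⟨e, he, he3⟩ : ∃ e ∈ P, orderOf e = 3 := ⟨z, z.2, (Subgroup.orderOf_coe z).trans hz⟩
  have heP : c * e * c⁻¹ ∈ P := Sylow.conj_mem_of_smul_eq hc he
  have hpow : e ^ 3 = 1 := by rw [← he3]; exact pow_orderOf_eq_one e
  have hpow' : (c * e * c⁻¹) ^ 3 = 1 := by rw [conj_pow, hpow]; group
  -- The involution `c ^ 2` inverts `P`, which is the relation `i² = -1`.
  have hinv : c * (c * e * c⁻¹) * c⁻¹ = e⁻¹ := by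
    have hs : c ^ 2 • P = P := by rw [pow_two, mul_smul, hc, hc]
    have hs' : c ^ 2 • P' = P' := by rw [pow_two, mul_smul, hc', hc']
    rw [← hG.conj_eq_inv_of_sq_eq_one hne hs hs' ?_ ?_ he]
    · simp only [pow_two, mul_inv_rev, mul_assoc]
    · rw [← pow_mul, show 2 * 2 = orderOf c from h4.symm]; exact pow_orderOf_eq_one c
    · exact pow_ne_one_of_lt_orderOf (by norm_num) (by rw [h4]; norm_num)
  have hcomm : Commute e (c * e * c⁻¹) := hG.mul_comm_of_mem he heP
  let u : Plane → G := fun v => e ^ v.1.val * (c * e * c⁻¹) ^ v.2.val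
  have hadd : ∀ v w, u (v + w) = u v * u w := by
    intro v w
    simp only [u, Prod.fst_add, Prod.snd_add, pow_zmod_val_add hpow, pow_zmod_val_add hpow']
    exact (hcomm.pow_pow w.1.val v.2.val).mul_mul_mul_comm _ _
  have hrot : ∀ v, c * u v * c⁻¹ = u (rot v) := by
    intro v
    calc c * u v * c⁻¹ = (c * e * c⁻¹) ^ v.1.val * (c * (c * e * c⁻¹) * c⁻¹) ^ v.2.val := by
          rw [conj_pow (a := c) (b := c * e * c⁻¹), conj_pow (a := c) (b := e) (i := v.1.val)]
          simp only [u, mul_assoc, inv_mul_cancel_left]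
      _ = u (rot v) := by
          rw [hinv, inv_pow_zmod_val hpow]
          exact (hcomm.pow_pow _ _).symm.eq
  have hone : u 0 = 1 := by simp [u]
  have hsmul : ∀ (n : ℕ) v, u v = 1 → u (n • v) = 1 := by
    intro n v hv
    induction n with
    | zero => rw [zero_smul, hone]
    | succ n ih => rw [succ_nsmul, hadd, ih, hv, mul_one]
  have hker : ∀ v, u v = 1 → v = 0 := by
    intro v hv
    by_contra h0
    have hv' : u (rot v) = 1 := by rw [← hrot, hv]; group
    -- The quarter turn has no eigenvector, as `-1` is not a square modulo 3. So a nonzero kernel,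
    -- being stable under it, would contain `(1, 0)`, whose image is `e ≠ 1`.
    have hspan : ∀ v : Plane, v ≠ 0 → ∃ m n : Fin 3, m.val • v + n.val • rot v = (1, 0) := by
      decide
    obtain ⟨m, n, hmn⟩ := hspan v h0
    have h1 : u (1, 0) = 1 := by rw [← hmn, hadd, hsmul _ _ hv, hsmul _ _ hv', mul_one]
    have h2 : u (1, 0) = e := by
      change e ^ 1 * (c * e * c⁻¹) ^ 0 = e
      rw [pow_one, pow_zero, mul_one]
    rw [h1] at h2
    rw [← h2, orderOf_one] at he3
    norm_num at he3
  refine ⟨u, fun v w h => ?_, fun v => mul_mem (pow_mem he _) (pow_mem heP _), hadd, hrot⟩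
  refine sub_eq_zero.1 (hker _ (mul_right_cancel (b := u w) ?_))
  rw [← hadd, sub_add_cancel, h, one_mul]

/-- `G` acts faithfully on the projective line over the field of nine elements, in the standard
way. -/
theorem exists_isZassenhaus :
    ∃ ρ : G →* Equiv.Perm (Option Plane), Function.Injective ρ ∧ IsZassenhaus ρ.range := by
  let P : Sylow 3 G := default
  have hnt : Nontrivial (Sylow 3 G) :=
    Finite.one_lt_card_iff_nontrivial.1 (by rw [hG.card_sylow_three]; norm_num)
  obtain ⟨P', hne⟩ := exists_ne P
  obtain ⟨c, hc, hc', h4⟩ := hG.exists_orderOf_eq_four hne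
  obtain ⟨t, ht, ht'⟩ := hG.exists_swap hne
  obtain ⟨u, hinj, hmem, hadd, hrot⟩ := hG.exists_coordinates hne hc hc' h4
  have hu0 : u 0 = 1 := by
    have := hadd 0 0
    rw [add_zero] at this
    exact left_eq_mul.1 this
  -- `P` becomes the point at infinity, `P'` the origin, and `u v • P'` the point `v`.
  let f : Option Plane → Sylow 3 G := fun o => o.elim P fun v => u v • P'
  have hf : Function.Injective f := by
    rintro (_ | v) (_ | w) h
    · rfl
    · exact absurd h.symm (smul_ne_of_mem hne (hmem w))
    · exact absurd h (smul_ne_of_mem hne (hmem v))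
    · exact congrArg some (hinj (hG.eq_of_smul_eq_smul hne (hmem v) (hmem w) h))
  have hcard : Nat.card (Sylow 3 G) ≤ Nat.card (Option Plane) := by
    rw [hG.card_sylow_three, Finite.card_option, Nat.card_prod, Nat.card_zmod]
  let ψ : Option Plane ≃ Sylow 3 G := Equiv.ofBijective f (hf.bijective_of_nat_card_le hcard)
  have hnone : ψ none = P := rfl
  have hsome : ∀ v, ψ (some v) = u v • P' := fun _ => rfl
  have hzero : ψ (some 0) = P' := by rw [hsome, hu0, one_smul]
  let ρ : G →* Equiv.Perm (Option Plane) :=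
    ψ.symm.permCongrHom.toMonoidHom.comp (MulAction.toPermHom G (Sylow 3 G))
  have hρ : ∀ g p, ψ (ρ g p) = g • ψ p := by
    intro g p
    change ψ (ψ.symm (g • ψ.symm.symm p)) = _
    simp
  have hρinj : Function.Injective ρ := by
    rw [injective_iff_map_eq_one]
    intro g hg
    refine hG.eq_one_of_forall_smul_eq fun R => ?_
    rw [← ψ.apply_symm_apply R, ← hρ, hg, Equiv.Perm.one_apply]
  have htransl : ∀ v, ρ (u v) = translPerm v := by
    intro v
    refine Equiv.ext fun p => ψ.injective ?_
    rw [hρ]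
    rcases p with _ | w
    · exact Sylow.smul_eq_of_mem (hmem v)
    · rw [translPerm_some, hsome, hsome, hadd, mul_smul]
  have hrotPerm : ρ c = rotPerm := by
    refine Equiv.ext fun p => ψ.injective ?_
    rw [hρ]
    rcases p with _ | w
    · exact hc
    · rw [rotPerm_some, hsome, hsome, ← hrot, mul_smul, mul_smul, inv_smul_eq_iff.2 hc'.symm]
  refine ⟨ρ, hρinj, fun v => ⟨u v, htransl v⟩, ⟨c, hrotPerm⟩, ⟨ρ t, ⟨t, rfl⟩, ?_, ?_⟩, ?_⟩
  · exact ψ.injective (by rw [hρ, hnone, hzero, ht])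
  · exact ψ.injective (by rw [hρ, hnone, hzero, ht'])
  · rintro _ ⟨g, rfl⟩ h0 h1
    have hg : g • P = P := by rw [← hnone, ← hρ, h0]
    have hg' : g • P' = P' := by rw [← hzero, ← hρ, h1]
    obtain ⟨j, hj, rfl⟩ := hG.exists_pow_eq hne hc hc' h4 hg hg'
    exact ⟨j, hj, by rw [map_pow, hrotPerm]⟩

/-- Both groups embed in the permutations of the projective line with the same image, by
`IsZassenhaus.eq`. -/
theorem nonempty_mulEquiv {H : Type*} [Group H] [Finite H] (hH : IsCoreFree360 H) :
    Nonempty (G ≃* H) := by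
  obtain ⟨ρ, hρ, hρZ⟩ := hG.exists_isZassenhaus
  obtain ⟨σ, hσ, hσZ⟩ := hH.exists_isZassenhaus
  exact ⟨(MonoidHom.ofInjective hρ).trans
    ((MulEquiv.subgroupCongr (hρZ.eq hσZ)).trans (MonoidHom.ofInjective hσ).symm)⟩

end IsCoreFree360

/-! ### The group `A₆` and the order of `G` -/

theorem natCard_alternatingGroup_six : Nat.card (alternatingGroup (Fin 6)) = 360 := by
  have h := two_mul_nat_card_alternatingGroup (α := Fin 6)
  rw [Nat.card_perm, Nat.card_fin, show Nat.factorial 6 = 720 by decide] at h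
  omega

theorem isSimpleGroup_alternatingGroup_six : IsSimpleGroup (alternatingGroup (Fin 6)) :=
  alternatingGroup.isSimpleGroup (by rw [Nat.card_fin]; norm_num)

theorem not_isPGroup_of_card_eq {G : Type*} [Group G] (hG : Nat.card G = 360) {p : ℕ}
    [Fact p.Prime] : ¬ IsPGroup p G := by
  intro h
  have : Finite G := Nat.finite_of_card_ne_zero (by rw [hG]; norm_num)
  obtain ⟨n, hn⟩ := IsPGroup.iff_card.1 h
  rw [hG] at hn
  have h2 : 2 ∣ p := Nat.prime_two.dvd_of_dvd_pow (n := n) (by rw [← hn]; norm_num)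
  have h3 : 3 ∣ p := Nat.prime_three.dvd_of_dvd_pow (n := n) (by rw [← hn]; norm_num)
  have hp : p.Prime := Fact.out
  rw [Nat.prime_dvd_prime_iff_eq (by norm_num) hp] at h2 h3
  omega

theorem isCoreFree360_alternatingGroup_six : IsCoreFree360 (alternatingGroup (Fin 6)) where
  card_eq := natCard_alternatingGroup_six
  eq_bot_of_normal p _ N hN hp := by
    have := isSimpleGroup_alternatingGroup_six
    refine hN.eq_bot_or_eq_top.resolve_right fun h => ?_
    subst h
    exact not_isPGroup_of_card_eq natCard_alternatingGroup_six (p := p)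
      (hp.of_equiv Subgroup.topEquiv)

theorem not_isSolvable_alternatingGroup_six : ¬ Group.IsSolvable (alternatingGroup (Fin 6)) := by
  intro h
  have := isSimpleGroup_alternatingGroup_six
  have hcomm := IsSimpleGroup.comm_iff_isSolvable.2 h
  obtain ⟨x, hx⟩ := exists_prime_orderOf_dvd_card' (G := alternatingGroup (Fin 6)) 2
    (by rw [natCard_alternatingGroup_six]; norm_num)
  have hn : (Subgroup.zpowers x).Normal := ⟨fun n hn g => by
    rwa [hcomm g n, mul_inv_cancel_right]⟩
  have hb := isCoreFree360_alternatingGroup_six.eq_bot_of_normal 2 _ hn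
    (isPGroup_zpowers_of_orderOf hx)
  rw [Subgroup.zpowers_eq_bot.1 hb, orderOf_one] at hx
  norm_num at hx

theorem solubleRadical_eq_bot_of_isSimpleGroup {G : Type*} [Group G] [IsSimpleGroup G]
    (hG : ¬ Group.IsSolvable G) : solubleRadical G = ⊥ := by
  refine sSup_eq_bot.2 fun N hN => hN.1.eq_bot_or_eq_top.resolve_right ?_
  rintro rfl
  have := hN.2
  exact hG (Group.isSolvable_of_surjective (f := (Subgroup.topEquiv (G := G)).toMonoidHom)
    (Subgroup.topEquiv (G := G)).surjective)

theorem natCard_compl_add_natCard {G : Type*} [Group G] [Finite G] (H : Subgroup G) :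
    Nat.card {x : G // x ∉ H} + Nat.card H = Nat.card G := by
  classical
  rw [add_comm, ← Nat.card_congr (Equiv.sumCompl fun x : G => x ∈ H), Nat.card_sum]

/-- A group with a subgroup of prime order and index two is soluble. -/
theorem isSolvable_of_prime_card_of_index_two {G : Type*} [Group G] (N : Subgroup G)
    (hN : (Nat.card N).Prime) (h2 : N.index = 2) : Group.IsSolvable G := by
  have hn : N.Normal := Subgroup.normal_of_index_eq_two h2
  have hs : ∀ {H : Type _} [Group H], (Nat.card H).Prime → Group.IsSolvable H := by
    intro H _ hH
    have : Fact (Nat.card H).Prime := ⟨hH⟩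
    have := isCyclic_of_prime_card (α := H) rfl
    exact Group.isSolvable_of_comm fun a b => (IsCyclic.isMulCommutative (α := H)).is_comm.comm a b
  have h1 := hs hN
  have h3 : Group.IsSolvable (G ⧸ N) := hs (by
    rw [← Subgroup.index_eq_card, h2]; exact Nat.prime_two)
  exact (Group.isSolvable_iff_subgroup_quotient N).2 ⟨h1, h3⟩

/-- A finite insoluble group with the same number of elements outside the soluble radical as `A₆`
has order `360` and trivial soluble radical. -/
theorem isCoreFree360_of_sameSolubilityGraph {G : Type*} [Group G] [Finite G]
    (hG : ¬ Group.IsSolvable G) (h : SameSolubilityGraph G (alternatingGroup (Fin 6))) :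
    IsCoreFree360 G := by
  obtain ⟨φ, hφ⟩ := h
  have := isSimpleGroup_alternatingGroup_six
  have h1 := natCard_compl_add_natCard (solubleRadical G)
  have h2 := natCard_compl_add_natCard (solubleRadical (alternatingGroup (Fin 6)))
  rw [← Nat.card_congr (Equiv.ofBijective φ hφ), natCard_alternatingGroup_six,
    Subgroup.card_eq_one.2
      (solubleRadical_eq_bot_of_isSimpleGroup not_isSolvable_alternatingGroup_six)] at h2
  have h3 : Nat.card {x : G // x ∉ solubleRadical G} = 359 := by omega
  rw [h3] at h1
  have hp : Nat.Prime 359 := by norm_num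
  have hmul := (solubleRadical G).card_mul_index
  -- The order of the radical divides `|G| = 359 + |R(G)|`.
  have hdvd : Nat.card (solubleRadical G) ∣ 359 := by
    rw [Nat.dvd_add_left (dvd_refl _) |>.symm, h1]
    exact ⟨_, hmul.symm⟩
  have hR : Nat.card (solubleRadical G) = 1 := by
    refine ((Nat.dvd_prime hp).1 hdvd).resolve_right fun h359 => hG ?_
    refine isSolvable_of_prime_card_of_index_two (solubleRadical G) (by rw [h359]; exact hp) ?_
    rw [← h1, h359] at hmul
    omega
  refine ⟨by omega, fun p _ N hN hNp => ?_⟩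
  -- A finite `p`-group is nilpotent, hence soluble.
  have hle : N ≤ solubleRadical G := by
    have := hNp.isNilpotent
    exact le_sSup ⟨hN, inferInstance⟩
  rw [Subgroup.card_eq_one.1 hR] at hle
  exact le_bot_iff.1 hle

/-- The first alternative always holds, and with it the final clause. -/
theorem mainTheorem12 (G : Type*) [Group G] [Finite G] (hG : ¬ Group.IsSolvable G)
    (h : SameSolubilityGraph G (alternatingGroup (Fin 6))) :
    (Nat.card G = Nat.card (alternatingGroup (Fin 6)) ∧ Nat.card G = 360) ∧
    (Nonempty (G ≃* alternatingGroup (Fin 6)) ∨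
      Nonempty (G ≃* Cyc 3 ⋊[signActionC3] Equiv.Perm (Fin 5)) ∨
      Nonempty (G ≃* Cyc 3 × Equiv.Perm (Fin 5)) ∨
      Nonempty (G ≃* Equiv.Perm (Fin 3) × alternatingGroup (Fin 5)) ∨
      Nonempty (G ≃* Cyc 6 × alternatingGroup (Fin 5)) ∨
      Nonempty (G ≃* Cyc 3 × Matrix.SpecialLinearGroup (Fin 2) (ZMod 5))) ∧
    (IsQuasisimpleGroup G ∨ IsAlmostSimpleGroup G →
      Nonempty (G ≃* alternatingGroup (Fin 6))) := by
  have hG' := isCoreFree360_of_sameSolubilityGraph hG h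
  have e := hG'.nonempty_mulEquiv isCoreFree360_alternatingGroup_six
  exact ⟨⟨hG'.card_eq.trans natCard_alternatingGroup_six.symm, hG'.card_eq⟩, Or.inl e, fun _ => e⟩
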